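/- Let $c\ge 1$ be an integer and $X$ a set. A quandle is a set $Q$ with a binary operation $\triangleright$ such that $x\triangleright(y\triangleright z)=(x\triangleright y)\triangleright(x\triangleright z)$, each map $x\triangleright(-)$ is bijective, and $x\triangleright x=x$. Every group, and every subset of a group stable under conjugation by the elements of the group, is a quandle for $g\triangleright h=ghg^{-1}$. Let $\mathrm{Inn}(Q)$ be the group generated by the automorphisms $x\triangleright(-)$ of $Q$, let $\Gamma_1(G)=G$, $\Gamma_{i+1}(G)=[G,\Gamma_i(G)]$ denote the lower central series of a group $G$, and call $Q$ $c$-nilpotent if $\Gamma_c(\mathrm{Inn}(Q))=1$. Let $Q/\Gamma_c$ be the quandle of orbits of $\Gamma_c(\mathrm{Inn}(Q))$ acting on $Q$, and let $G(Q)=\langle Q\mid x\triangleright y=xyx^{-1}\ (x,y\in Q)\rangle$ be the enveloping group of $Q$. Let $F[X]$ be the free group on $X$ and $Q[X]\subseteq F[X]$ the union of the conjugacy classes of the elements of $X$ (the free quandle on $X$). Proposition. (1) The free $c$-nilpotent quandle on $X$ is the subquandle $Q_c[X]$ of the conjugation quandle of the free $c$-nilpotent group $F[X]/\Gamma_{c+1}(F[X])$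 formed by the disjoint union of the conjugacy classes of the (images of the) elements of $X$. That is: the basis elements attached to distinct elements of $X$ are not conjugate in $F[X]/\Gamma_{c+1}(F[X])$; the quandle $Q_c[X]$ is $c$-nilpotent; and every map from $X$ to a $c$-nilpotent quandle $R$ extends uniquely to a quandle morphism $Q_c[X]\to R$. (2) There is an isomorphism $G(Q[X]/\Gamma_c)\cong F[X]/\Gamma_{c+1}(F[X])$ sending the generator given by the class of $q\in Q[X]$ to the class of $q$. The canonical map from $Q[X]/\Gamma_c$ to its enveloping group is injective, and its image in $F[X]/\Gamma_{c+1}(F[X])$ is $Q_c[X]$. -/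

import Mathlib

open scoped Quandles

universe u v

/-- The lower central series with the indexing `Γ₁(G) = G`, `Γ_{i+1}(G) = [G, Γ_i(G)]`
(used only for `n ≥ 1`). A group `G` is `c`-nilpotent iff `Γ_{c+1}(G) = 1`. -/
abbrev Gam (G : Type u) [Group G] (n : ℕ) : Subgroup G :=
  (⊤ : Subgroup G).lowerCentralSeries (n - 1)

/-- The group of inner automorphisms of a quandle: the group of permutations generated by the
maps `x ◃ (-)`. Its elements are automorphisms of `Q`, see `Inn.map_act`. -/
def Inn (Q : Type u) [Quandle Q] : Subgroup (Equiv.Perm Q) :=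
  Subgroup.closure (Set.range (Rack.act' (R := Q)))

/-- A quandle is `c`-nilpotent (`c ≥ 1`) if the group `Inn(Q)` is `(c-1)`-nilpotent, that is, if
`Γ_c(Inn(Q))` is trivial. -/
def IsNilpotentQuandle (c : ℕ) (Q : Type u) [Quandle Q] : Prop :=
  Gam (Inn Q) c = ⊥

section InnLemmas

variable {Q : Type u} [Quandle Q]

theorem Inn.map_act {g : Equiv.Perm Q} (hg : g ∈ Inn Q) (x y : Q) :
    g (x ◃ y) = g x ◃ g y := by
  induction hg using Subgroup.closure_induction generalizing x y with
  | mem g hg =>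
    obtain ⟨z, rfl⟩ := hg
    exact Shelf.self_distrib
  | one => rfl
  | mul a b _ _ iha ihb => simp only [Equiv.Perm.mul_apply, ihb, iha]
  | inv a _ iha =>
    apply a.injective
    rw [iha]
    simp

/-- The behaviour `x ◃ (-)` of `x`, as an element of `Inn(Q)`. -/
def Inn.of (x : Q) : Inn Q :=
  ⟨Rack.act' x, Subgroup.subset_closure ⟨x, rfl⟩⟩

theorem Inn.of_smul (x y : Q) : Inn.of x • y = x ◃ y := rfl

theorem Inn.of_inv_smul (x y : Q) : (Inn.of x)⁻¹ • y = x ◃⁻¹ y := rfl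

theorem Inn.of_smul_eq (g : Inn Q) (x : Q) : Inn.of (g • x) = g * Inn.of x * g⁻¹ := by
  rw [eq_mul_inv_iff_mul_eq]
  apply Subtype.ext
  ext y
  exact (Inn.map_act g.2 x y).symm

end InnLemmas

/-- The quotient `Q/Γ_c` of a quandle by the orbits of the action of `Γ_c(Inn(Q))`. -/
def QuandleModGam (Q : Type u) [Quandle Q] (c : ℕ) : Type u :=
  MulAction.orbitRel.Quotient (Gam (Inn Q) c) Q

namespace QuandleModGam

variable {Q : Type u} [Quandle Q] {c : ℕ}

/-- The projection `Q → Q/Γ_c`. -/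
def mk (c : ℕ) (x : Q) : QuandleModGam Q c :=
  Quotient.mk (MulAction.orbitRel (Gam (Inn Q) c) Q) x

theorem smul_rel {x x' y y' : Q} (a : Q → Inn Q)
    (ha : ∀ (g : Inn Q) (z : Q), a (g • z) = g * a z * g⁻¹)
    (hx : MulAction.orbitRel (Gam (Inn Q) c) Q x x')
    (hy : MulAction.orbitRel (Gam (Inn Q) c) Q y y') :
    MulAction.orbitRel (Gam (Inn Q) c) Q (a x • y) (a x' • y') := by
  rw [MulAction.orbitRel_apply] at hx hy ⊢
  obtain ⟨⟨g, hg⟩, rfl⟩ := hx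
  obtain ⟨⟨h, hh⟩, rfl⟩ := hy
  refine ⟨⟨g * (a x' * (g⁻¹ * h) * (a x')⁻¹), ?_⟩, ?_⟩
  · refine mul_mem hg (Subgroup.Normal.conj_mem inferInstance _ (mul_mem (inv_mem hg) hh) _)
  · change (g * (a x' * (g⁻¹ * h) * (a x')⁻¹)) • (a x' • y') = a (g • x') • (h • y')
    rw [ha, smul_smul, smul_smul]
    congr 1
    group

/-- The law induced by that of `Q`. -/
instance : Quandle (QuandleModGam Q c) where
  act := Quotient.map₂ (fun x y => x ◃ y) fun _ _ hx _ _ hy =>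
    smul_rel (c := c) Inn.of Inn.of_smul_eq hx hy
  self_distrib {x y z} := by
    induction x using Quotient.inductionOn
    induction y using Quotient.inductionOn
    induction z using Quotient.inductionOn
    exact congrArg (Quotient.mk _) Shelf.self_distrib
  invAct := Quotient.map₂ (fun x y => x ◃⁻¹ y) fun _ _ hx _ _ hy =>
    smul_rel (c := c) (fun x => (Inn.of x)⁻¹)
      (fun g x => by rw [Inn.of_smul_eq]; group) hx hy
  left_inv x y := by
    induction x using Quotient.inductionOn
    induction y using Quotient.inductionOn
    exact congrArg (Quotient.mk _) (Rack.left_inv _ _)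
  right_inv x y := by
    induction x using Quotient.inductionOn
    induction y using Quotient.inductionOn
    exact congrArg (Quotient.mk _) (Rack.right_inv _ _)
  fix {x} := by
    induction x using Quotient.inductionOn
    exact congrArg (Quotient.mk _) Quandle.fix

end QuandleModGam

/-- For a family `b : X → G` of elements of a group, the union of the conjugacy classes of
the `b x`. -/
def conjUnion {X : Type u} {G : Type v} [Group G] (b : X → G) : Set G :=
  {g | ∃ x, IsConj (b x) g}

/-- `conjUnion b` as a subquandle of the conjugation quandle of `G`. -/
def ConjUnion {X : Type u} {G : Type v} [Group G] (b : X → G) : Type v :=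
  {g : G // g ∈ conjUnion b}

namespace ConjUnion

variable {X : Type u} {G : Type v} [Group G] {b : X → G}

theorem conj_mem {g : G} (hg : g ∈ conjUnion b) (w : G) : w * g * w⁻¹ ∈ conjUnion b := by
  obtain ⟨x, hx⟩ := hg
  exact ⟨x, hx.trans (isConj_iff.2 ⟨w, rfl⟩)⟩

/-- The law is `g ◃ h = g * h * g⁻¹`. -/
instance : Quandle (ConjUnion b) where
  act g h := ⟨g.1 * h.1 * g.1⁻¹, conj_mem h.2 g.1⟩
  self_distrib {x y z} := Subtype.ext (by simp [mul_assoc])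
  invAct g h := ⟨g.1⁻¹ * h.1 * g.1, by simpa using conj_mem h.2 g.1⁻¹⟩
  left_inv x y := Subtype.ext (by simp [mul_assoc])
  right_inv x y := Subtype.ext (by simp [mul_assoc])
  fix {x} := Subtype.ext (by simp)

/-- The inclusion, as a morphism of quandles. -/
def incl (b : X → G) : ConjUnion b →◃ Quandle.Conj G where
  toFun g := g.1
  map_act' := rfl

/-- The element `b x` of `ConjUnion b`. -/
def of (b : X → G) (x : X) : ConjUnion b := ⟨b x, x, IsConj.refl _⟩

end ConjUnion

/-- The free quandle `Q[X]`: the union of the conjugacy classes of the elements of the basis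
in the free group `F[X]`. -/
abbrev FreeQdl (X : Type u) : Type u := ConjUnion (FreeGroup.of : X → FreeGroup X)

/-- The free `c`-nilpotent group `F[X]/Γ_{c+1}`. -/
abbrev FreeNilpotentGroup (X : Type u) (c : ℕ) : Type u :=
  FreeGroup X ⧸ Gam (FreeGroup X) (c + 1)

/-- The basis of the free `c`-nilpotent group. -/
def FreeNilpotentGroup.basis (X : Type u) (c : ℕ) (x : X) : FreeNilpotentGroup X c :=
  QuotientGroup.mk (FreeGroup.of x)

/-! Write F for F[X]. Everything rests on one fact: if u commutes with a basis element x modulo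
Γ_{c+1}(F), then u lies in Γ_c(F) up to a power of x (`exists_mul_zpow_mem_Gam`). Exponent sums show
that distinct basis elements are not conjugate, so the class of w x w⁻¹ modulo Γ_{c+1} determines x,
and determines w up to Γ_c and powers of x (`eq_mul_zpow_of_mk_conj_eq`). On a c-nilpotent quandle
Γ_c of the inner group acts trivially, and powers of x are harmless because x ▷ x = x. Hence w x w⁻¹
↦ ρ(w) • f(x) is well defined, which gives freeness; the same ambiguity in w shows that Q[X]/Γ_c
embeds in F/Γ_{c+1}. In the enveloping group of Q[X]/Γ_c the image of Γ_c is central, since Γ_c acts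
trivially on that quandle; so Γ_{c+1} dies and F/Γ_{c+1} maps back to the enveloping group.

The centralizer fact comes from the Magnus expansion x ↦ 1 + x t. Commutation with x forces the
coefficients of u in degrees below c to commute with the letter x, hence to be polynomials in x.
Killing the other letters therefore does not change them, and turns u into some x^k, so u x⁻ᵏ
expands to 1 modulo t^c. Magnus's theorem then puts u x⁻ᵏ in Γ_c. That theorem is proved by Lazard
elimination (`FreeLeadFamily.mem_Gam_of_hasLead`): a generator y₀ of least weight is split off, and
the others are replaced by their iterated commutators with y₀, whose leading terms again generate a
free algebra (`iteratedBracket_free`). -/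

open scoped commutatorElement

/-! ### Lower central series and leading terms of power series. -/

open PowerSeries in
/-- The power series `f` is congruent to `1 + a X ^ n` modulo `X ^ (n + 1)`. -/
def HasLead {T : Type*} [Ring T] (f : PowerSeries T) (n : ℕ) (a : T) : Prop :=
  ∃ r : PowerSeries T, f = 1 + X ^ n * r ∧ constantCoeff r = a

/-- The three subgroups lemma, applied in the quotient by N. -/
theorem Subgroup.commutator_commutator_le_of_rotate {G : Type*} [Group G] {A B C N : Subgroup G}
    [N.Normal] (h1 : ⁅⁅B, C⁆, A⁆ ≤ N) (h2 : ⁅⁅C, A⁆, B⁆ ≤ N) : ⁅⁅A, B⁆, C⁆ ≤ N := by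
  have key : ∀ K : Subgroup G, K ≤ N ↔ K.map (QuotientGroup.mk' N) = ⊥ := fun K => by
    rw [Subgroup.map_eq_bot_iff, QuotientGroup.ker_mk']
  rw [key] at *
  simp only [Subgroup.map_commutator] at *
  exact Subgroup.commutator_commutator_eq_bot_of_rotate h1 h2

theorem Subgroup.commutator_lowerCentralSeries_le {G : Type*} [Group G] (i j : ℕ) :
    ⁅(⊤ : Subgroup G).lowerCentralSeries i, (⊤ : Subgroup G).lowerCentralSeries j⁆ ≤
      (⊤ : Subgroup G).lowerCentralSeries (i + j + 1) := by
  induction j generalizing i with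
  | zero => exact le_rfl
  | succ j ih =>
    rw [Subgroup.lowerCentralSeries_succ, Subgroup.commutator_comm]
    apply Subgroup.commutator_commutator_le_of_rotate
    · rw [Subgroup.commutator_comm ⊤]
      exact (ih (i + 1)).trans_eq (by congr 1; omega)
    · exact Subgroup.commutator_mono (ih i) le_rfl

theorem Gam_commutator_mem {G : Type*} [Group G] {i j : ℕ} (hi : 1 ≤ i) (hj : 1 ≤ j) {g h : G}
    (hg : g ∈ Gam G i) (hh : h ∈ Gam G j) : ⁅g, h⁆ ∈ Gam G (i + j) := by
  have := Subgroup.commutator_lowerCentralSeries_le (G := G) (i - 1) (j - 1)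
    (Subgroup.commutator_mem_commutator hg hh)
  rwa [show i - 1 + (j - 1) + 1 = i + j - 1 by omega] at this

theorem Gam_antitone {G : Type*} [Group G] {i j : ℕ} (h : i ≤ j) : Gam G j ≤ Gam G i :=
  Subgroup.lowerCentralSeries_antitone _ (Nat.sub_le_sub_right h 1)

namespace HasLead

open PowerSeries

variable {T : Type*} [Ring T] {f g : PowerSeries T} {n m : ℕ} {a b : T}

theorem one (n : ℕ) : HasLead (1 : PowerSeries T) n 0 := ⟨0, by simp⟩

theorem mul (hn : 1 ≤ n) (hf : HasLead f n a) (hg : HasLead g n b) :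
    HasLead (f * g) n (a + b) := by
  obtain ⟨r, rfl, rfl⟩ := hf
  obtain ⟨s, rfl, rfl⟩ := hg
  refine ⟨r + s + X ^ n * (r * s), ?_, ?_⟩
  · have : X ^ n * r * (X ^ n * s) = X ^ n * (X ^ n * (r * s)) := by
      rw [mul_assoc, ← mul_assoc r, ← X_pow_mul (φ := r), mul_assoc]
    simp only [mul_add, add_mul, one_mul, mul_one, this]
    abel
  · simp [show n ≠ 0 by omega]

theorem unique (hf : HasLead f n a) (hg : HasLead f n b) : a = b := by
  obtain ⟨r, rfl, rfl⟩ := hf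
  obtain ⟨s, hs, rfl⟩ := hg
  rw [X_pow_mul_cancel (add_left_cancel hs)]

theorem of_lt (hf : HasLead f n a) (h : m < n) : HasLead f m 0 := by
  obtain ⟨r, rfl, rfl⟩ := hf
  refine ⟨X ^ (n - m) * r, ?_, ?_⟩
  · rw [← mul_assoc, ← pow_add, Nat.add_sub_cancel' h.le]
  · simp [show n - m ≠ 0 by omega]

theorem constantCoeff_eq (hn : 1 ≤ n) (hf : HasLead f n a) : constantCoeff f = 1 := by
  obtain ⟨r, rfl, rfl⟩ := hf
  simp [show n ≠ 0 by omega]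

theorem constantCoeff_inv {U : (PowerSeries T)ˣ} (h : constantCoeff (U : PowerSeries T) = 1) :
    constantCoeff (↑U⁻¹ : PowerSeries T) = 1 := by
  have := congrArg constantCoeff U.inv_mul
  rwa [map_mul, h, mul_one, map_one] at this

theorem inv {U : (PowerSeries T)ˣ} (hn : 1 ≤ n) (h : HasLead (U : PowerSeries T) n a) :
    HasLead (↑U⁻¹ : PowerSeries T) n (-a) := by
  have h0 := constantCoeff_inv (h.constantCoeff_eq hn)
  obtain ⟨r, hr, rfl⟩ := h
  refine ⟨-(r * ↑U⁻¹), ?_, by simp [h0]⟩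
  have := U.mul_inv
  rw [hr, add_mul, one_mul] at this
  rw [mul_neg, ← mul_assoc, ← sub_eq_add_neg, eq_sub_iff_add_eq, this]

theorem zpow {U : (PowerSeries T)ˣ} (hn : 1 ≤ n) (h : HasLead (U : PowerSeries T) n a) (k : ℤ) :
    HasLead (↑(U ^ k) : PowerSeries T) n (k • a) := by
  induction k with
  | zero => simpa using one n
  | succ k ih =>
    rw [zpow_add_one, add_smul, one_smul, Units.val_mul]
    exact ih.mul hn h
  | pred k ih =>
    rw [zpow_sub_one, sub_smul, one_smul, Units.val_mul, sub_eq_add_neg (_ • a)]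
    exact ih.mul hn (h.inv hn)

/-- The constant terms 1 and all one-sided terms cancel in UV − VU, leaving X^(n+m)(rs − sr);
multiplying UV on the right by U⁻¹V⁻¹ = (VU)⁻¹ gives the commutator. -/
theorem commutator {U V : (PowerSeries T)ˣ} (hn : 1 ≤ n) (hm : 1 ≤ m)
    (hU : HasLead (U : PowerSeries T) n a) (hV : HasLead (V : PowerSeries T) m b) :
    HasLead (↑⁅U, V⁆ : PowerSeries T) (n + m) (a * b - b * a) := by
  have hU' := constantCoeff_inv (hU.constantCoeff_eq hn)
  have hV' := constantCoeff_inv (hV.constantCoeff_eq hm)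
  obtain ⟨r, hr, rfl⟩ := hU
  obtain ⟨s, hs, rfl⟩ := hV
  refine ⟨(r * s - s * r) * (↑U⁻¹ * ↑V⁻¹), ?_, by simp [hU', hV']⟩
  have e1 : X ^ n * r * (X ^ m * s) = X ^ (n + m) * (r * s) := by
    rw [mul_assoc, ← mul_assoc r, ← X_pow_mul (φ := r), mul_assoc, pow_add, mul_assoc]
  have e2 : X ^ m * s * (X ^ n * r) = X ^ (n + m) * (s * r) := by
    rw [mul_assoc, ← mul_assoc s, ← X_pow_mul (φ := s), mul_assoc, add_comm n, pow_add, mul_assoc]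
  have e3 : (U : PowerSeries T) * (V : PowerSeries T) = (V : PowerSeries T) * (U : PowerSeries T) +
      X ^ (n + m) * (r * s - s * r) := by
    rw [hr, hs, mul_sub, ← e1, ← e2]
    noncomm_ring
  have e4 : ((V : PowerSeries T) * (U : PowerSeries T)) *
      ((↑U⁻¹ : PowerSeries T) * (↑V⁻¹ : PowerSeries T)) = 1 := by
    norm_cast
    simp
  rw [commutatorElement_def, Units.val_mul, Units.val_mul, Units.val_mul, mul_assoc, e3, add_mul,
    e4, mul_assoc]

end HasLead

/-! ### Leading terms along the lower central series. -/

section Filtration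

variable {T : Type*} [Ring T] {G : Type*} [Group G] (φ : G →* (PowerSeries T)ˣ)

/-- The elements of `G` whose image is `1 + a X ^ n` modulo `X ^ (n + 1)`, with `a ∈ S`. -/
def leadSubgroup (n : ℕ) (hn : 1 ≤ n) (S : AddSubgroup T) : Subgroup G where
  carrier := {g | ∃ a ∈ S, HasLead (φ g : PowerSeries T) n a}
  one_mem' := ⟨0, S.zero_mem, by simpa using HasLead.one n⟩
  mul_mem' := by
    rintro g h ⟨a, ha, hg⟩ ⟨b, hb, hh⟩
    exact ⟨a + b, S.add_mem ha hb, by simpa using hg.mul hn hh⟩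
  inv_mem' := by
    rintro g ⟨a, ha, hg⟩
    exact ⟨-a, S.neg_mem ha, by simpa using hg.inv hn⟩

theorem hasLead_of_mem_Gam (hφ : ∀ g, ∃ a, HasLead (φ g : PowerSeries T) 1 a) {n : ℕ}
    (hn : 1 ≤ n) {g : G} (hg : g ∈ Gam G n) : ∃ a, HasLead (φ g : PowerSeries T) n a := by
  suffices h : Gam G n ≤ leadSubgroup φ n hn ⊤ by
    obtain ⟨a, -, ha⟩ := h hg
    exact ⟨a, ha⟩
  clear hg g
  induction n, hn using Nat.le_induction with
  | base =>
    intro g _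
    obtain ⟨a, ha⟩ := hφ g
    exact ⟨a, trivial, ha⟩
  | succ n hn ih =>
    -- The index n − 1 is truncated, so this recursion holds only for n ≥ 1.
    have e : Gam G (n + 1) = ⁅Gam G n, (⊤ : Subgroup G)⁆ := by
      obtain ⟨k, rfl⟩ := Nat.exists_eq_add_of_le' hn
      rfl
    rw [e, Subgroup.commutator_le]
    intro g hg h _
    obtain ⟨a, -, ha⟩ := ih hg
    obtain ⟨b, hb⟩ := hφ h
    exact ⟨_, trivial, by simpa [map_commutatorElement] using ha.commutator hn le_rfl hb⟩

end Filtration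

/-! ### Lazard elimination in the free algebra. -/

section FreeAlgebraElimination

variable (R : Type*) [CommRing R] {Y : Type*}

/-- The iterated commutators `ad(y₀)^i (y)` in the free algebra, for `y ≠ y₀`. -/
noncomputable def iteratedBracket (y₀ : Y) (z : {y // y ≠ y₀} × ℕ) : FreeAlgebra R Y :=
  (fun t => FreeAlgebra.ι R y₀ * t - t * FreeAlgebra.ι R y₀)^[z.2] (FreeAlgebra.ι R z.1.1)

/-- Given a self-map `s` of a set `Z`, there is an endomorphism `D` of the module
`FreeAlgebra R Z` whose commutator with the multiplication by `z` is the multiplication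
by `s z`. -/
theorem FreeAlgebra.exists_derivation {Z : Type*} (s : Z → Z) :
    ∃ D : Module.End R (FreeAlgebra R Z), ∀ z t,
      D (FreeAlgebra.ι R z * t) = FreeAlgebra.ι R (s z) * t + FreeAlgebra.ι R z * D t := by
  -- A derivation is the second component of an algebra morphism into the dual numbers lifting the
  -- identity.
  let Δ : FreeAlgebra R Z →ₐ[R] TrivSqZeroExt (FreeAlgebra R Z) (FreeAlgebra R Z) :=
    FreeAlgebra.lift R fun z =>
      TrivSqZeroExt.inl (FreeAlgebra.ι R z) + TrivSqZeroExt.inr (FreeAlgebra.ι R (s z))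
  have hfst : ∀ t, (Δ t).fst = t := fun t => by
    have : (TrivSqZeroExt.fstHom R (FreeAlgebra R Z) (FreeAlgebra R Z)).comp Δ =
        AlgHom.id R _ := by
      ext z
      simp [Δ]
    exact DFunLike.congr_fun this t
  refine ⟨{ toFun := fun t => (Δ t).snd, map_add' := by simp, map_smul' := by simp }, ?_⟩
  intro z t
  have e1 : (Δ (FreeAlgebra.ι R z)).snd = FreeAlgebra.ι R (s z) := by simp [Δ]
  simp [hfst, e1, add_comm]

/-- The free algebra on Y acts on the free algebra on the pairs (y, i): y₀ acts by the derivation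
(y, i) ↦ (y, i + 1), and each other y by left multiplication by (y, 0). Bracketing with the
derivation shifts i, so the i-th iterated bracket acts as left multiplication by (y, i). Acting on 1
recovers any polynomial from its image. -/
theorem iteratedBracket_free (y₀ : Y) :
    Function.Injective (FreeAlgebra.lift R (iteratedBracket R y₀)) := by
  classical
  obtain ⟨D, hD⟩ := FreeAlgebra.exists_derivation R
    (fun z : {y // y ≠ y₀} × ℕ => (z.1, z.2 + 1))
  let ρ : FreeAlgebra R Y →ₐ[R] Module.End R (FreeAlgebra R ({y // y ≠ y₀} × ℕ)) :=
    FreeAlgebra.lift R fun y =>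
      if h : y = y₀ then D else Algebra.lmul R _ (FreeAlgebra.ι R (⟨y, h⟩, 0))
  have hρ₀ : ρ (FreeAlgebra.ι R y₀) = D := by simp [ρ]
  have hρ : ρ.comp (FreeAlgebra.lift R (iteratedBracket R y₀)) = Algebra.lmul R _ := by
    ext z : 2
    obtain ⟨y, i⟩ := z
    simp only [Function.comp_apply, FreeAlgebra.lift_ι_apply, AlgHom.coe_comp]
    induction i with
    | zero =>
      have := y.2
      simp [iteratedBracket, ρ, this]
    | succ i ih =>
      have e : iteratedBracket R y₀ (y, i + 1) = FreeAlgebra.ι R y₀ * iteratedBracket R y₀ (y, i) -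
          iteratedBracket R y₀ (y, i) * FreeAlgebra.ι R y₀ := by
        simp only [iteratedBracket, Function.iterate_succ_apply']
      rw [e, map_sub, map_mul, map_mul, ih, hρ₀]
      refine LinearMap.ext fun t => ?_
      simp [hD]
  intro p q hpq
  have e : ∀ p, ρ (FreeAlgebra.lift R (iteratedBracket R y₀) p) 1 = p := fun p => by
    have := DFunLike.congr_fun hρ p
    rw [AlgHom.comp_apply] at this
    rw [this]
    simp
  rw [← e p, ← e q, hpq]

end FreeAlgebraElimination

/-! ### Lazard elimination in the group, and detection of Γ_N by leading terms. -/

/-- A family of elements `y` of a group with weights `w y`, lying in `Γ_{w y}`, whose leading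
terms `a y X ^ (w y)` freely generate a free algebra. -/
structure FreeLeadFamily {T : Type*} [Ring T] {G : Type*} [Group G] (φ : G →* (PowerSeries T)ˣ)
    (Y : Type u) where
  /-- The elements of the group. -/
  elt : Y → G
  /-- Their weights. -/
  weight : Y → ℕ
  /-- The coefficients of their leading terms. -/
  lead : Y → T
  one_le_weight : ∀ y, 1 ≤ weight y
  mem_Gam : ∀ y, elt y ∈ Gam G (weight y)
  hasLead : ∀ y, HasLead (φ (elt y) : PowerSeries T) (weight y) (lead y)
  finite : ∀ n, {y | weight y = n}.Finite
  free : Function.Injective (FreeAlgebra.lift ℤ lead)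

namespace FreeLeadFamily

variable {T : Type*} [Ring T] {G : Type*} [Group G] {φ : G →* (PowerSeries T)ˣ} {Y : Type u}

/-- Elimination of `y₀`: the family of the iterated commutators of `y₀` with the others. -/
def elim (B : FreeLeadFamily φ Y) (y₀ : Y) : FreeLeadFamily φ ({y // y ≠ y₀} × ℕ) where
  elt z := (fun t => ⁅B.elt y₀, t⁆)^[z.2] (B.elt z.1)
  weight z := B.weight z.1 + z.2 * B.weight y₀
  lead z := (fun t => B.lead y₀ * t - t * B.lead y₀)^[z.2] (B.lead z.1)
  one_le_weight z := (B.one_le_weight z.1).trans (Nat.le_add_right _ _)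
  mem_Gam := by
    rintro ⟨y, i⟩
    induction i with
    | zero => simpa using B.mem_Gam y
    | succ i ih =>
      rw [Function.iterate_succ_apply']
      have := Gam_commutator_mem (B.one_le_weight y₀)
        ((B.one_le_weight y.1).trans (Nat.le_add_right _ _)) (B.mem_Gam y₀) ih
      rwa [show B.weight y.1 + (i + 1) * B.weight y₀ =
        B.weight y₀ + (B.weight y.1 + i * B.weight y₀) by ring]
  hasLead := by
    rintro ⟨y, i⟩
    induction i with
    | zero => simpa using B.hasLead y
    | succ i ih =>
      simp only [Function.iterate_succ_apply'] at ih ⊢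
      have := (B.hasLead y₀).commutator (B.one_le_weight y₀)
        ((B.one_le_weight y.1).trans (Nat.le_add_right _ _)) ih
      rwa [show B.weight y.1 + (i + 1) * B.weight y₀ =
        B.weight y₀ + (B.weight y.1 + i * B.weight y₀) by ring, map_commutatorElement]
  finite n := by
    -- A pair (y, i) has weight at least the weight of y, and at least i because y₀ has weight at
    -- least 1; both components are thus bounded.
    have h1 : {y | B.weight y ≤ n}.Finite := by
      refine ((Set.finite_Iic n).biUnion fun k _ => B.finite k).subset fun y hy => ?_
      simpa using hy
    refine ((h1.preimage Subtype.val_injective.injOn).prod (Set.finite_Iic n)).subset ?_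
    rintro ⟨y, i⟩ h
    have h : B.weight y.1 + i * B.weight y₀ = n := h
    have := Nat.le_mul_of_pos_right i (B.one_le_weight y₀)
    simp only [Set.mem_prod, Set.mem_preimage, Set.mem_ofPred_eq, Set.mem_Iic]
    omega
  free := by
    have e : FreeAlgebra.lift ℤ (fun z : {y // y ≠ y₀} × ℕ =>
        (fun t => B.lead y₀ * t - t * B.lead y₀)^[z.2] (B.lead z.1)) =
        (FreeAlgebra.lift ℤ B.lead).comp (FreeAlgebra.lift ℤ (iteratedBracket ℤ y₀)) := by
      ext z
      obtain ⟨y, i⟩ := z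
      simp only [Function.comp_apply, FreeAlgebra.lift_ι_apply, AlgHom.coe_comp]
      induction i with
      | zero => simp [iteratedBracket]
      | succ i ih =>
        simp only [iteratedBracket, Function.iterate_succ_apply'] at ih ⊢
        rw [map_sub, map_mul, map_mul, FreeAlgebra.lift_ι_apply, ih]
    rw [e]
    exact B.free.comp (iteratedBracket_free ℤ y₀)

/-- The subgroup generated by the family and `Γ_N`. -/
def span (B : FreeLeadFamily φ Y) (N : ℕ) : Subgroup G :=
  Subgroup.closure (Set.range B.elt) ⊔ Gam G N

theorem elt_mem_span (B : FreeLeadFamily φ Y) (N : ℕ) (y : Y) : B.elt y ∈ B.span N :=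
  Subgroup.mem_sup_left (Subgroup.subset_closure ⟨y, rfl⟩)

theorem elim_elt_succ (B : FreeLeadFamily φ Y) (y₀ : Y) (y : {y // y ≠ y₀}) (i : ℕ) :
    (B.elim y₀).elt (y, i + 1) = ⁅B.elt y₀, (B.elim y₀).elt (y, i)⁆ :=
  Function.iterate_succ_apply' _ _ _

theorem conj_elim_elt_mem (B : FreeLeadFamily φ Y) (N : ℕ) (y₀ : Y)
    (z : {y // y ≠ y₀} × ℕ) :
    B.elt y₀ * (B.elim y₀).elt z * (B.elt y₀)⁻¹ ∈ (B.elim y₀).span N := by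
  obtain ⟨y, i⟩ := z
  have e : B.elt y₀ * (B.elim y₀).elt (y, i) * (B.elt y₀)⁻¹ =
      (B.elim y₀).elt (y, i + 1) * (B.elim y₀).elt (y, i) := by
    rw [elim_elt_succ, commutatorElement_def]
    group
  rw [e]
  exact mul_mem (elt_mem_span _ _ _) (elt_mem_span _ _ _)

theorem conj_inv_elim_elt_mem (B : FreeLeadFamily φ Y) (N : ℕ) (y₀ : Y)
    (z : {y // y ≠ y₀} × ℕ) :
    (B.elt y₀)⁻¹ * (B.elim y₀).elt z * (B.elt y₀) ∈ (B.elim y₀).span N := by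
  obtain ⟨y, i⟩ := z
  -- Descending induction on i: once i ≥ N the iterated commutator lies in Γ_N, which is normal.
  obtain ⟨k, hk⟩ : ∃ k, N ≤ i + k := ⟨N, Nat.le_add_left _ _⟩
  induction k generalizing i with
  | zero =>
    have h1 : (B.elim y₀).elt (y, i) ∈ Gam G N := by
      refine Gam_antitone ?_ ((B.elim y₀).mem_Gam (y, i))
      have : i ≤ i * B.weight y₀ := Nat.le_mul_of_pos_right i (B.one_le_weight y₀)
      change N ≤ B.weight y.1 + i * B.weight y₀
      omega
    refine Subgroup.mem_sup_right ?_
    simpa using Subgroup.Normal.conj_mem inferInstance _ h1 (B.elt y₀)⁻¹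
  | succ k ih =>
    -- With a = y₀ and z the i-th commutator: a⁻¹za = (a⁻¹[a, z]a)⁻¹ z, which only involves the
    -- conjugate of the next commutator.
    have e : (B.elt y₀)⁻¹ * (B.elim y₀).elt (y, i) * (B.elt y₀) =
        ((B.elt y₀)⁻¹ * (B.elim y₀).elt (y, i + 1) * (B.elt y₀))⁻¹ *
          (B.elim y₀).elt (y, i) := by
      rw [elim_elt_succ, commutatorElement_def]
      group
    rw [e]
    exact mul_mem (inv_mem (ih (i + 1) (by omega))) (elt_mem_span _ _ _)

theorem map_conj_span_le (B : FreeLeadFamily φ Y) (N : ℕ) (K : Subgroup G) (g : G)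
    (hN : Gam G N ≤ K) (h : ∀ y, g * B.elt y * g⁻¹ ∈ K) {x : G} (hx : x ∈ B.span N) :
    g * x * g⁻¹ ∈ K := by
  suffices h : B.span N ≤ K.comap (MulAut.conj g).toMonoidHom by exact h hx
  refine sup_le ?_ fun x hx => hN (Subgroup.Normal.conj_mem inferInstance _ hx g)
  rw [Subgroup.closure_le]
  rintro _ ⟨y, rfl⟩
  exact h y

theorem mem_normalizer_elim_span (B : FreeLeadFamily φ Y) (N : ℕ) (y₀ : Y) :
    B.elt y₀ ∈ Subgroup.normalizer ((B.elim y₀).span N : Set G) := by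
  rw [Subgroup.mem_normalizer_iff]
  intro h
  refine ⟨map_conj_span_le _ N _ _ le_sup_right (B.conj_elim_elt_mem N y₀), fun hh => ?_⟩
  have := map_conj_span_le _ N _ (B.elt y₀)⁻¹ le_sup_right
    (fun z => by rw [inv_inv]; exact B.conj_inv_elim_elt_mem N y₀ z) hh
  rwa [mul_assoc, mul_assoc, inv_inv, mul_assoc, inv_mul_cancel, mul_one,
    inv_mul_cancel_left] at this

/-- Since y₀ normalizes the eliminated subgroup, the subgroup that they generate together is the set
of products. -/
theorem exists_eq_zpow_mul (B : FreeLeadFamily φ Y) (N : ℕ) (y₀ : Y) {h : G}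
    (hh : h ∈ B.span N) : ∃ k : ℤ, ∃ h' ∈ (B.elim y₀).span N, h = B.elt y₀ ^ k * h' := by
  have h1 : B.span N ≤ Subgroup.zpowers (B.elt y₀) ⊔ (B.elim y₀).span N := by
    refine sup_le ?_ (le_sup_right.trans le_sup_right)
    rw [Subgroup.closure_le]
    rintro _ ⟨y, rfl⟩
    by_cases hy : y = y₀
    · exact hy ▸ Subgroup.mem_sup_left (Subgroup.mem_zpowers _)
    · exact Subgroup.mem_sup_right ((B.elim y₀).elt_mem_span N (⟨y, hy⟩, 0))
  have h2 := h1 hh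
  rw [← SetLike.mem_coe, Subgroup.coe_mul_of_left_le_normalizer_right _ _
    ((Subgroup.zpowers_le).2 (B.mem_normalizer_elim_span N y₀))] at h2
  obtain ⟨_, ⟨k, rfl⟩, h', hh', rfl⟩ := h2
  exact ⟨k, h', hh', rfl⟩

/-- In the least weight, that of y₀, only the uncommutated pairs (y, 0) can contribute; longer
commutators and Γ_N lie strictly deeper. -/
theorem hasLead_of_mem_elim_span (hφ : ∀ g, ∃ a, HasLead (φ g : PowerSeries T) 1 a)
    (B : FreeLeadFamily φ Y) {N : ℕ} {y₀ : Y} (hmin : ∀ y, B.weight y₀ ≤ B.weight y)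
    (hN : B.weight y₀ < N) {h : G} (hh : h ∈ (B.elim y₀).span N) :
    ∃ a ∈ AddSubgroup.closure (B.lead '' {y | y ≠ y₀}),
      HasLead (φ h : PowerSeries T) (B.weight y₀) a := by
  suffices H : (B.elim y₀).span N ≤ leadSubgroup φ (B.weight y₀) (B.one_le_weight y₀)
      (AddSubgroup.closure (B.lead '' {y | y ≠ y₀})) from H hh
  refine sup_le ?_ fun g hg => ?_
  · rw [Subgroup.closure_le]
    rintro _ ⟨⟨y, i⟩, rfl⟩
    have h1 := (B.elim y₀).hasLead (y, i)
    by_cases hw : B.weight y₀ < (B.elim y₀).weight (y, i)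
    · exact ⟨0, zero_mem _, h1.of_lt hw⟩
    have h2 : ¬ B.weight y₀ < B.weight y.1 + i * B.weight y₀ := hw
    have h3 := hmin y
    have h4 := B.one_le_weight y₀
    obtain rfl : i = 0 := by
      by_contra hi
      have := Nat.le_mul_of_pos_left (B.weight y₀) (Nat.pos_of_ne_zero hi)
      omega
    refine ⟨B.lead y, AddSubgroup.subset_closure ⟨y.1, y.2, rfl⟩, ?_⟩
    rw [show B.weight y₀ = B.weight y.1 by omega]
    exact B.hasLead y
  · obtain ⟨a, ha⟩ := hasLead_of_mem_Gam φ hφ (by omega) hg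
    exact ⟨0, zero_mem _, ha.of_lt hN⟩

theorem eq_zero_of_smul_add_eq_zero (B : FreeLeadFamily φ Y) {y₀ : Y} {k : ℤ} {s : T}
    (hs : s ∈ AddSubgroup.closure (B.lead '' {y | y ≠ y₀})) (h : k • B.lead y₀ + s = 0) :
    k = 0 := by
  classical
  -- The augmentation sending y₀ to 1 and the other letters to 0 reads off k, once the relation is
  -- lifted to the free algebra by freeness.
  let π : FreeAlgebra ℤ Y →ₐ[ℤ] ℤ := FreeAlgebra.lift ℤ (Pi.single y₀ 1)
  obtain ⟨t, ht, rfl⟩ : ∃ t, π t = 0 ∧ FreeAlgebra.lift ℤ B.lead t = s := by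
    clear h
    induction hs using AddSubgroup.closure_induction with
    | mem x hx =>
      obtain ⟨y, hy, rfl⟩ := hx
      exact ⟨FreeAlgebra.ι ℤ y, by simp [π, Pi.single_eq_of_ne hy], by simp⟩
    | zero => exact ⟨0, by simp, by simp⟩
    | add _ _ _ _ h1 h2 =>
      obtain ⟨t, ht, rfl⟩ := h1
      obtain ⟨t', ht', rfl⟩ := h2
      exact ⟨t + t', by simp [ht, ht'], by simp⟩
    | neg _ _ h1 =>
      obtain ⟨t, ht, rfl⟩ := h1
      exact ⟨-t, by simp [ht], by simp⟩
  have h1 : k • FreeAlgebra.ι ℤ y₀ + t = 0 := B.free (by simpa using h)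
  simpa [ht, π] using congrArg π h1

/-- An element of the subgroup generated by the family and `Γ_N` lies in `Γ_N` as soon as its
image is `1` modulo `X ^ N`. -/
theorem mem_Gam_of_hasLead (hφ : ∀ g, ∃ a, HasLead (φ g : PowerSeries T) 1 a) {N : ℕ}
    (B : FreeLeadFamily φ Y) {h : G} (hh : h ∈ B.span N) {a : T}
    (ha : HasLead (φ h : PowerSeries T) N a) : h ∈ Gam G N := by
  -- Outer induction on d, where m bounds the weights from below and N ≤ m + d; inner induction on
  -- the number of members of weight m. The family and its index set change at each elimination.
  obtain ⟨d, m, hd, hm⟩ : ∃ d m, N ≤ m + d ∧ ∀ y, m ≤ B.weight y :=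
    ⟨N, 0, by omega, fun _ => Nat.zero_le _⟩
  induction d generalizing Y m with
  | zero =>
    have h1 : B.span N ≤ Gam G N := by
      refine sup_le ?_ le_rfl
      rw [Subgroup.closure_le]
      rintro _ ⟨y, rfl⟩
      exact Gam_antitone (hd.trans (hm y)) (B.mem_Gam y)
    exact h1 hh
  | succ d ihd =>
    obtain ⟨k, hk⟩ : ∃ k, {y | B.weight y = m}.ncard = k := ⟨_, rfl⟩
    induction k using Nat.strong_induction_on generalizing Y with
    | _ k ihk =>
    by_cases hy : ∃ y₀, B.weight y₀ = m
    · obtain ⟨y₀, rfl⟩ := hy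
      by_cases hN : N ≤ B.weight y₀
      · exact ihd B hh (B.weight y₀) (by omega) hm
      obtain ⟨j, h', hh', e⟩ := B.exists_eq_zpow_mul N y₀ hh
      obtain ⟨s, hs, hs'⟩ := B.hasLead_of_mem_elim_span hφ hm (by omega) hh'
      have h1 := ((B.hasLead y₀).zpow (B.one_le_weight y₀) j).mul (B.one_le_weight y₀) hs'
      rw [← map_zpow, ← Units.val_mul, ← map_mul, ← e] at h1
      -- The weight of y₀ is below N, so the coefficient of h in that degree vanishes. This forces
      -- the exponent of y₀ to be 0, and h already lies in the eliminated subgroup.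
      obtain rfl := B.eq_zero_of_smul_add_eq_zero hs (h1.unique (ha.of_lt (by omega)))
      rw [zpow_zero, one_mul] at e
      subst e
      refine ihk _ ?_ (B.elim y₀) hh'
        (fun z : {y // y ≠ y₀} × ℕ => (hm z.1).trans (Nat.le_add_right _ _)) rfl
      rw [← hk]
      -- The members of weight m after elimination are among the old ones, without y₀.
      have h2 : {z | (B.elim y₀).weight z = B.weight y₀}.ncard ≤
          ({y | B.weight y = B.weight y₀} \ {y₀}).ncard := by
        have key : ∀ z : {y // y ≠ y₀} × ℕ, (B.elim y₀).weight z = B.weight y₀ →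
            B.weight z.1.1 = B.weight y₀ ∧ z.2 = 0 := by
          rintro ⟨y, i⟩ hz
          have hz : B.weight y.1 + i * B.weight y₀ = B.weight y₀ := hz
          have h3 := hm y
          have h4 := B.one_le_weight y₀
          obtain rfl : i = 0 := by
            by_contra hi
            have := Nat.le_mul_of_pos_left (B.weight y₀) (Nat.pos_of_ne_zero hi)
            omega
          exact ⟨by simpa using hz, rfl⟩
        refine Set.ncard_le_ncard_of_injOn (fun z => z.1.1) (fun z hz => ⟨(key z hz).1, z.1.2⟩)
          ?_ (B.finite _).sdiff
        intro z hz z' hz' e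
        exact Prod.ext (Subtype.ext e) ((key z hz).2.trans (key z' hz').2.symm)
      exact h2.trans_lt (Set.ncard_sdiff_singleton_lt_of_mem rfl (B.finite _))
    · push Not at hy
      exact ihd B hh (m + 1) (by omega) fun y => lt_of_le_of_ne (hm y) (hy y).symm

end FreeLeadFamily

/-! ### The centralizer of a letter in the free algebra. -/

section Centralizer

variable (R : Type*) [CommRing R] {X : Type*}

/-- The endomorphism of the free algebra fixing the letter `x` and killing the others. -/
noncomputable def FreeAlgebra.onlyLetter [DecidableEq X] (x : X) :
    FreeAlgebra R X →ₐ[R] FreeAlgebra R X :=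
  FreeAlgebra.lift R fun y => if y = x then FreeAlgebra.ι R x else 0

variable {R}

/-- Compare the coefficients of y l v x in xp = px. The right side gives that of y l v in p. The
left side gives 0 if y ≠ x, and the coefficient of l v x if y = x: the leading x moves to the end,
and the induction continues until a foreign letter comes first. The suffix v must be arbitrary to
absorb these letters. -/
theorem MonoidAlgebra.coeff_eq_zero_of_commute_letter {x : X} {p : MonoidAlgebra R (FreeMonoid X)}
    (h : MonoidAlgebra.single (FreeMonoid.of x) 1 * p =
      p * MonoidAlgebra.single (FreeMonoid.of x) 1)
    (l v : FreeMonoid X) (hl : ∃ y ∈ l.toList, y ≠ x) : p.coeff (l * v) = 0 := by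
  induction l using FreeMonoid.inductionOn' generalizing v with
  | one => simp at hl
  | of_mul y l ih =>
    have h1 := congrArg (fun q => q.coeff (FreeMonoid.of y * l * v * FreeMonoid.of x)) h
    rw [MonoidAlgebra.coeff_mul_single_eq_coeff_mul (FreeMonoid.of y * l * v)
      (fun m' _ => mul_left_inj _), mul_one] at h1
    rw [← h1]
    by_cases hy : y = x
    · subst hy
      rw [mul_assoc, mul_assoc,
        MonoidAlgebra.coeff_single_mul_eq_mul_coeff (l * (v * FreeMonoid.of y))
        (fun m' _ => mul_right_inj _), one_mul]
      refine ih _ ?_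
      simpa using hl
    · apply MonoidAlgebra.coeff_single_mul_of_forall_mul_ne
      intro d hd
      have := congrArg FreeMonoid.toList hd
      simp only [FreeMonoid.toList_mul, FreeMonoid.toList_of, List.cons_append, List.nil_append,
        List.cons.injEq] at this
      exact hy this.1.symm

/-- All words in the support of f are powers of x, and these are fixed. -/
theorem FreeAlgebra.onlyLetter_eq_self_of_commute [DecidableEq X] {x : X} {f : FreeAlgebra R X}
    (h : FreeAlgebra.ι R x * f = f * FreeAlgebra.ι R x) : FreeAlgebra.onlyLetter R x f = f := by
  let e := FreeAlgebra.equivMonoidAlgebraFreeMonoid (R := R) (X := X)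
  have he : ∀ y, e (FreeAlgebra.ι R y) = MonoidAlgebra.single (FreeMonoid.of y) 1 := fun y => by
    simp [e, FreeAlgebra.equivMonoidAlgebraFreeMonoid, MonoidAlgebra.of]
  have h1 : MonoidAlgebra.single (FreeMonoid.of x) 1 * e f =
      e f * MonoidAlgebra.single (FreeMonoid.of x) 1 := by
    rw [← he, ← map_mul, h, map_mul]
  have h2 : ∀ l : FreeMonoid X, (∀ y ∈ l.toList, y = x) →
      FreeAlgebra.onlyLetter R x (e.symm (MonoidAlgebra.single l 1)) =
        e.symm (MonoidAlgebra.single l 1) := by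
    intro l hl
    induction l using FreeMonoid.inductionOn' with
    | one =>
      rw [← MonoidAlgebra.one_def, map_one, map_one]
    | of_mul y l ih =>
      have e1 : MonoidAlgebra.single (FreeMonoid.of y * l) (1 : R) =
        e (FreeAlgebra.ι R y) * MonoidAlgebra.single l 1 := by simp [he]
      have hyx : y = x := hl y (by simp)
      rw [e1, map_mul, map_mul, ih fun z hz => hl z (by simp [hz]), e.symm_apply_apply, hyx]
      simp [FreeAlgebra.onlyLetter]
  have h3 : f = (e f).coeff.sum fun l r => r • e.symm (MonoidAlgebra.single l 1) := by
    conv_lhs => rw [← e.symm_apply_apply f, ← MonoidAlgebra.sum_coeff_single (e f)]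
    rw [map_finsuppSum]
    refine Finsupp.sum_congr fun l _ => ?_
    rw [← map_smul, MonoidAlgebra.smul_single, smul_eq_mul, mul_one]
  rw [h3, map_finsuppSum]
  refine Finsupp.sum_congr fun l hl => ?_
  rw [map_smul, h2]
  intro y hy
  by_contra hyx
  have := MonoidAlgebra.coeff_eq_zero_of_commute_letter h1 l 1 ⟨y, hy, hyx⟩
  rw [mul_one] at this
  exact (Finsupp.mem_support_iff.1 hl) this

end Centralizer

/-! ### The Magnus expansion and centralizers modulo Γ_{c+1}. -/

section Magnus

open PowerSeries

variable (X : Type u)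

/-- The Magnus expansion `x ↦ 1 + x t` of the free group. -/
noncomputable def magnus : FreeGroup X →* (PowerSeries (FreeAlgebra ℤ X))ˣ :=
  FreeGroup.lift fun x =>
    { val := 1 + PowerSeries.X ^ 1 * C (FreeAlgebra.ι ℤ x)
      inv := invOfUnit (1 + PowerSeries.X ^ 1 * C (FreeAlgebra.ι ℤ x)) 1
      val_inv := mul_invOfUnit _ _ (by simp)
      inv_val := invOfUnit_mul _ _ (by simp) }

variable {X}

theorem magnus_of (x : X) : (magnus X (FreeGroup.of x) : PowerSeries (FreeAlgebra ℤ X)) =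
    1 + PowerSeries.X ^ 1 * C (FreeAlgebra.ι ℤ x) := by
  simp [magnus]

theorem hasLead_magnus_of (x : X) :
    HasLead (magnus X (FreeGroup.of x) : PowerSeries (FreeAlgebra ℤ X)) 1 (FreeAlgebra.ι ℤ x) :=
  ⟨_, magnus_of x, by simp⟩

theorem exists_hasLead_magnus (g : FreeGroup X) :
    ∃ a, HasLead (magnus X g : PowerSeries (FreeAlgebra ℤ X)) 1 a := by
  suffices h : (⊤ : Subgroup (FreeGroup X)) ≤ leadSubgroup (magnus X) 1 le_rfl ⊤ by
    obtain ⟨a, -, ha⟩ := h (Subgroup.mem_top g)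
    exact ⟨a, ha⟩
  rw [← FreeGroup.closure_range_of, Subgroup.closure_le]
  rintro _ ⟨x, rfl⟩
  exact ⟨_, trivial, hasLead_magnus_of x⟩

/-- The letters in a finite set, with weight `1`. -/
noncomputable def letterFamily (S : Finset X) : FreeLeadFamily (magnus X) S where
  elt x := FreeGroup.of x.1
  weight _ := 1
  lead x := FreeAlgebra.ι ℤ x.1
  one_le_weight _ := le_rfl
  mem_Gam _ := Subgroup.mem_top _
  hasLead x := hasLead_magnus_of x.1
  finite _ := Set.toFinite _
  free := by
    classical
    let π : FreeAlgebra ℤ X →ₐ[ℤ] FreeAlgebra ℤ S :=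
      FreeAlgebra.lift ℤ fun x => if h : x ∈ S then FreeAlgebra.ι ℤ ⟨x, h⟩ else 0
    refine Function.LeftInverse.injective (g := π) fun t => ?_
    have : π.comp (FreeAlgebra.lift ℤ fun x : S => FreeAlgebra.ι ℤ x.1) = AlgHom.id ℤ _ := by
      ext x
      simp [π]
    exact DFunLike.congr_fun this t

theorem FreeGroup.exists_finset_mem_closure (u : FreeGroup X) :
    ∃ S : Finset X, u ∈ Subgroup.closure (FreeGroup.of '' (S : Set X)) := by
  classical
  induction u using FreeGroup.induction_on with
  | C1 => exact ⟨∅, one_mem _⟩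
  | of x => exact ⟨{x}, Subgroup.subset_closure ⟨x, by simp, rfl⟩⟩
  | inv_of x h =>
    obtain ⟨S, hS⟩ := h
    exact ⟨S, inv_mem hS⟩
  | mul a b ha hb =>
    obtain ⟨S, hS⟩ := ha
    obtain ⟨S', hS'⟩ := hb
    refine ⟨S ∪ S', mul_mem (Subgroup.closure_mono ?_ hS) (Subgroup.closure_mono ?_ hS')⟩
    · exact Set.image_mono (by simp)
    · exact Set.image_mono (by simp)

/-- Magnus's theorem: an element of the free group whose Magnus expansion is `1` modulo
degree `N` lies in `Γ_N`. -/
theorem mem_Gam_of_hasLead_magnus {N : ℕ} {u : FreeGroup X} {a : FreeAlgebra ℤ X}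
    (h : HasLead (magnus X u : PowerSeries (FreeAlgebra ℤ X)) N a) : u ∈ Gam (FreeGroup X) N := by
  -- Elimination needs finitely many members in each weight, hence the reduction to finitely many
  -- letters.
  obtain ⟨S, hS⟩ := FreeGroup.exists_finset_mem_closure u
  refine (letterFamily S).mem_Gam_of_hasLead exists_hasLead_magnus (Subgroup.mem_sup_left ?_) h
  convert hS
  ext
  simp [letterFamily]

/-- The centralizer of a basis element `x` in the free nilpotent group `F/Γ_{c+1}` is generated
by `x` and `Γ_c/Γ_{c+1}`. -/
theorem exists_mul_zpow_mem_Gam {c : ℕ} {u : FreeGroup X} {x : X}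
    (h : ⁅u, FreeGroup.of x⁆ ∈ Gam (FreeGroup X) (c + 1)) :
    ∃ k : ℤ, u * FreeGroup.of x ^ k ∈ Gam (FreeGroup X) c := by
  classical
  obtain ⟨a, r, hr, -⟩ := hasLead_of_mem_Gam (magnus X) exists_hasLead_magnus
    (Nat.le_add_left 1 c) h
  have hcomm : (magnus X u : PowerSeries (FreeAlgebra ℤ X)) * (magnus X (FreeGroup.of x)).val =
      (magnus X (FreeGroup.of x)).val * (magnus X u).val + PowerSeries.X ^ (c + 1) *
        (r * ((magnus X (FreeGroup.of x)).val * (magnus X u).val)) := by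
    have e : u * FreeGroup.of x = ⁅u, FreeGroup.of x⁆ * (FreeGroup.of x * u) := by
      rw [commutatorElement_def]
      group
    rw [← Units.val_mul, ← map_mul, e, map_mul, Units.val_mul, hr, map_mul, Units.val_mul, add_mul,
      one_mul, mul_assoc]
  -- In degree k + 1 ≤ c the error term of `hcomm` vanishes, and what remains says that the k-th
  -- coefficient commutes with x.
  have hcoeff : ∀ k < c, FreeAlgebra.onlyLetter ℤ x
      (coeff k (magnus X u : PowerSeries (FreeAlgebra ℤ X))) =
      coeff k (magnus X u : PowerSeries (FreeAlgebra ℤ X)) := by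
    intro k hk
    apply FreeAlgebra.onlyLetter_eq_self_of_commute
    have h1 := congrArg (coeff (k + 1)) hcomm
    rw [map_add, coeff_X_pow_mul', if_neg (by omega), add_zero, magnus_of, mul_add, add_mul,
      mul_one, one_mul, map_add, map_add, pow_one, mul_assoc PowerSeries.X, coeff_succ_X_mul,
      ← mul_assoc, ← (commute_X _).eq.symm, mul_assoc PowerSeries.X, coeff_succ_X_mul,
      coeff_mul_C, coeff_C_mul] at h1
    exact (add_left_cancel h1).symm
  -- The group-level counterpart of `onlyLetter`: the Magnus expansion intertwines the two, so
  -- killing the other letters in the expansion of u yields the expansion of a power of x.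
  let ε : FreeGroup X →* FreeGroup X :=
    FreeGroup.lift fun y => if y = x then FreeGroup.of x else 1
  have hε : ∃ k : ℤ, ε u = FreeGroup.of x ^ k := by
    have h1 : (⊤ : Subgroup (FreeGroup X)) ≤ (Subgroup.zpowers (FreeGroup.of x)).comap ε := by
      rw [← FreeGroup.closure_range_of, Subgroup.closure_le]
      rintro _ ⟨y, rfl⟩
      by_cases hy : y = x
      · simp [ε, hy]
      · simp [ε, hy, one_mem]
    obtain ⟨k, hk⟩ := h1 (Subgroup.mem_top u)
    exact ⟨k, hk.symm⟩
  obtain ⟨k, hk⟩ := hε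
  have hmap : PowerSeries.map (FreeAlgebra.onlyLetter ℤ x).toRingHom
      (magnus X u : PowerSeries (FreeAlgebra ℤ X)) = magnus X (FreeGroup.of x ^ k) := by
    have h1 : (Units.map (PowerSeries.map
        (FreeAlgebra.onlyLetter ℤ x).toRingHom).toMonoidHom).comp (magnus X) =
        (magnus X).comp ε := by
      ext y : 2
      simp only [MonoidHom.comp_apply, Units.coe_map, magnus_of, ε, FreeGroup.lift_apply_of]
      by_cases hy : y = x
      · simp [hy, magnus_of, FreeAlgebra.onlyLetter]
      · simp [hy, FreeAlgebra.onlyLetter]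
    rw [← hk]
    exact congrArg Units.val (DFunLike.congr_fun h1 u)
  refine ⟨-k, ?_⟩
  have hdvd : (PowerSeries.X : PowerSeries (FreeAlgebra ℤ X)) ^ c ∣
      (magnus X u).val - (magnus X (FreeGroup.of x ^ k)).val := by
    rw [PowerSeries.X_pow_dvd_iff]
    intro m hm
    rw [map_sub, ← hmap, coeff_map, sub_eq_zero]
    exact (hcoeff m hm).symm
  obtain ⟨s, hs⟩ := hdvd
  have hlead : HasLead (magnus X (u * FreeGroup.of x ^ (-k))).val c
      (constantCoeff (s * (magnus X (FreeGroup.of x ^ k))⁻¹.val)) := by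
    refine ⟨s * (magnus X (FreeGroup.of x ^ k))⁻¹.val, ?_, rfl⟩
    rw [sub_eq_iff_eq_add] at hs
    rw [zpow_neg, map_mul, map_inv, Units.val_mul, hs, add_mul, Units.mul_inv, add_comm, mul_assoc]
  exact mem_Gam_of_hasLead_magnus hlead

end Magnus

/-! ### Conjugates of basis elements in the free nilpotent group. -/

theorem Gam_map_mem {G H : Type*} [Group G] [Group H] (f : G →* H) {n : ℕ} {g : G}
    (hg : g ∈ Gam G n) : f g ∈ Gam H n :=
  Subgroup.lowerCentralSeries_mono (n - 1) le_top
    (Subgroup.map_lowerCentralSeries ⊤ f (n - 1) ▸ Subgroup.mem_map_of_mem f hg)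

theorem FreeNilpotentGroup.Gam_eq_bot (X : Type u) (c : ℕ) :
    Gam (FreeNilpotentGroup X c) (c + 1) = ⊥ := by
  have h := Subgroup.map_lowerCentralSeries (⊤ : Subgroup (FreeGroup X))
    (QuotientGroup.mk' (Gam (FreeGroup X) (c + 1))) (c + 1 - 1)
  rw [Subgroup.map_top_of_surjective _ (QuotientGroup.mk'_surjective _)] at h
  refine h.symm.trans ?_
  rw [Subgroup.map_eq_bot_iff, QuotientGroup.ker_mk']

section ConjugationModGam

variable {X : Type u} {c : ℕ}

theorem eq_of_isConj_basis (hc : 1 ≤ c) {x y : X}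
    (h : IsConj (FreeNilpotentGroup.basis X c x) (FreeNilpotentGroup.basis X c y)) : x = y := by
  classical
  -- The exponent sum in x; it factors through F/Γ_{c+1} because c ≥ 1 gives Γ_{c+1} ≤ Γ_2.
  let ψ : FreeGroup X →* Multiplicative ℤ :=
    FreeGroup.lift fun z => if z = x then Multiplicative.ofAdd 1 else 1
  have hψ : Gam (FreeGroup X) (c + 1) ≤ ψ.ker := by
    refine (Gam_antitone (show 2 ≤ c + 1 by omega)).trans ?_
    change ⁅(⊤ : Subgroup (FreeGroup X)), ⊤⁆ ≤ ψ.ker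
    rw [Subgroup.commutator_le]
    intro a _ b _
    rw [MonoidHom.mem_ker, map_commutatorElement, commutatorElement_eq_one_iff_mul_comm, mul_comm]
  have h1 := (QuotientGroup.lift _ ψ hψ).map_isConj h
  rw [isConj_iff_eq] at h1
  have h2 : ψ (FreeGroup.of x) = ψ (FreeGroup.of y) := h1
  by_contra hxy
  simp [ψ, Ne.symm hxy] at h2

/-- Two conjugates of basis elements that agree in `F/Γ_{c+1}` are conjugates of the same basis
element, by elements that differ by its centralizer. -/
theorem eq_mul_zpow_of_mk_conj_eq (hc : 1 ≤ c) {w v : FreeGroup X} {x y : X}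
    (h : (QuotientGroup.mk (w * FreeGroup.of x * w⁻¹) : FreeNilpotentGroup X c) =
      QuotientGroup.mk (v * FreeGroup.of y * v⁻¹)) :
    x = y ∧ ∃ t ∈ Gam (FreeGroup X) c, ∃ k : ℤ, w = v * t * FreeGroup.of x ^ k := by
  obtain rfl : x = y := by
    refine eq_of_isConj_basis hc ((isConj_iff.2 ⟨QuotientGroup.mk w, ?_⟩).trans
      (isConj_iff.2 ⟨QuotientGroup.mk v, ?_⟩ : IsConj (FreeNilpotentGroup.basis X c y)
        (QuotientGroup.mk (v * FreeGroup.of y * v⁻¹))).symm)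
    · exact h
    · rfl
  refine ⟨rfl, ?_⟩
  have h1 : ⁅v⁻¹ * w, FreeGroup.of x⁆ ∈ Gam (FreeGroup X) (c + 1) := by
    have h2 := (QuotientGroup.eq.1 h.symm)
    -- Conjugation by x v⁻¹ turns (v x v⁻¹)⁻¹(w x w⁻¹) into [v⁻¹w, x].
    have h3 := Subgroup.Normal.conj_mem inferInstance _ h2 (FreeGroup.of x * v⁻¹)
    convert h3 using 1
    rw [commutatorElement_def]
    group
  obtain ⟨k, hk⟩ := exists_mul_zpow_mem_Gam h1
  exact ⟨_, hk, -k, by group⟩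

end ConjugationModGam

/-! ### Inner automorphisms of unions of conjugacy classes. -/

namespace ConjUnion

section

variable {X : Type u} {G : Type v} [Group G] (b : X → G)

/-- The action of `G` on `ConjUnion b` by conjugation. -/
def conjHom : G →* Equiv.Perm (ConjUnion b) where
  toFun w :=
    { toFun := fun q => ⟨w * q.1 * w⁻¹, conj_mem q.2 w⟩
      invFun := fun q => ⟨w⁻¹ * q.1 * w, by simpa using conj_mem q.2 w⁻¹⟩
      left_inv := fun q => Subtype.ext (by simp [mul_assoc])
      right_inv := fun q => Subtype.ext (by simp [mul_assoc]) }
  map_one' := Equiv.ext fun q => Subtype.ext (by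
    change 1 * q.1 * 1⁻¹ = q.1
    simp)
  map_mul' w v := Equiv.ext fun q => Subtype.ext (by
    change w * v * q.1 * (w * v)⁻¹ = w * (v * q.1 * v⁻¹) * w⁻¹
    group)

variable {b}

theorem conjHom_coe (w : G) (q : ConjUnion b) : (conjHom b w q).1 = w * q.1 * w⁻¹ := rfl

/-- Each q acts as conjugation by an element of G, so the inner group lies in the image of G, and
lower central series are monotone and commute with images. -/
theorem exists_conjHom_eq {n : ℕ} {g : Inn (ConjUnion b)} (hg : g ∈ Gam (Inn (ConjUnion b)) n) :
    ∃ w ∈ Gam G n, conjHom b w = g.1 := by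
  have h1 : Inn (ConjUnion b) ≤ (⊤ : Subgroup G).map (conjHom b) := by
    rw [Inn, Subgroup.closure_le]
    rintro _ ⟨q, rfl⟩
    exact ⟨q.1, trivial, rfl⟩
  have h2 := Subgroup.mem_map_of_mem (Inn (ConjUnion b)).subtype hg
  rw [Gam, Subgroup.top_subtype_lowerCentralSeries] at h2
  have h3 : g.1 ∈ ((⊤ : Subgroup G).map (conjHom b)).lowerCentralSeries (n - 1) :=
    Subgroup.lowerCentralSeries_mono (n - 1) h1 h2
  rw [← Subgroup.map_lowerCentralSeries] at h3
  exact h3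

/-- Elements of Γ_c(G) are central when Γ_{c+1}(G) is trivial, so they act trivially by conjugation.
-/
theorem isNilpotentQuandle {c : ℕ} (hc : 1 ≤ c) (hG : Gam G (c + 1) = ⊥) :
    IsNilpotentQuandle c (ConjUnion b) := by
  rw [IsNilpotentQuandle, eq_bot_iff]
  intro g hg
  obtain ⟨w, hw, hwg⟩ := exists_conjHom_eq hg
  rw [Subgroup.mem_bot]
  refine Subtype.ext ?_
  rw [← hwg]
  refine Equiv.ext fun q => Subtype.ext ?_
  have h1 := Gam_commutator_mem hc le_rfl hw (Subgroup.mem_top q.1)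
  rw [hG, Subgroup.mem_bot, commutatorElement_eq_one_iff_mul_comm] at h1
  rw [conjHom_coe, h1, mul_inv_cancel_right]
  rfl

/-- A map that is equivariant for the generators of a free group is equivariant. -/
theorem map_conjHom {A S : Type*} [Group A] [MulAction A S] (β : FreeGroup X →* G)
    (θ : FreeGroup X →* A) (F : ConjUnion b → S)
    (h : ∀ x q, F (conjHom b (β (FreeGroup.of x)) q) = θ (FreeGroup.of x) • F q)
    (w : FreeGroup X) (q : ConjUnion b) : F (conjHom b (β w) q) = θ w • F q := by
  induction w using FreeGroup.induction_on generalizing q with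
  | C1 => simp
  | of x => exact h x q
  | inv_of x ih =>
    rw [map_inv θ, eq_inv_smul_iff, ← ih, map_inv, map_inv, ← Equiv.Perm.mul_apply, mul_inv_cancel,
      Equiv.Perm.one_apply]
  | mul a b iha ihb => rw [map_mul, map_mul, map_mul, Equiv.Perm.mul_apply, iha, ihb, mul_smul]

end

end ConjUnion

/-! ### Freeness among c-nilpotent quandles. -/

section UniversalProperty

variable {X : Type u} {c : ℕ}

theorem exists_eq_mk_conj (q : ConjUnion (FreeNilpotentGroup.basis X c)) :
    ∃ (w : FreeGroup X) (x : X), q.1 = QuotientGroup.mk (w * FreeGroup.of x * w⁻¹) := by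
  obtain ⟨g, x, hx⟩ := q
  obtain ⟨w, rfl⟩ := isConj_iff.1 hx
  obtain ⟨w, rfl⟩ := QuotientGroup.mk_surjective w
  exact ⟨w, x, rfl⟩

theorem existsUnique_extension (hc : 1 ≤ c) {R : Type v} [Quandle R]
    (hR : IsNilpotentQuandle c R) (f : X → R) :
    ∃! F : ConjUnion (FreeNilpotentGroup.basis X c) →◃ R,
      ∀ x, F (ConjUnion.of (FreeNilpotentGroup.basis X c) x) = f x := by
  let ρ : FreeGroup X →* Inn R := FreeGroup.lift fun x => Inn.of (f x)
  have hρ : ∀ x, ρ (FreeGroup.of x) = Inn.of (f x) := fun x => by simp [ρ]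
  have hρ1 : ∀ t ∈ Gam (FreeGroup X) c, ρ t = 1 := fun t ht => by
    have := Gam_map_mem ρ ht
    rwa [hR, Subgroup.mem_bot] at this
  have hfix : ∀ (x : X) (k : ℤ), ρ (FreeGroup.of x ^ k) • f x = f x := fun x k => by
    rw [map_zpow, hρ]
    have : Inn.of (f x) ∈ MulAction.stabilizer (Inn R) (f x) := Quandle.fix
    exact zpow_mem this k
  choose w x hwx using exists_eq_mk_conj (X := X) (c := c)
  -- The value does not depend on the chosen expression of q: a factor in Γ_c acts trivially on R,
  -- and a power of x fixes f x.
  have hspec : ∀ q v y, q.1 = QuotientGroup.mk (v * FreeGroup.of y * v⁻¹) →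
      ρ (w q) • f (x q) = ρ v • f y := by
    intro q v y h
    obtain ⟨e, t, ht, k, hk⟩ := eq_mul_zpow_of_mk_conj_eq hc ((hwx q).symm.trans h)
    rw [hk, map_mul, map_mul, hρ1 t ht, mul_one, mul_smul, hfix, e]
  let F : ConjUnion (FreeNilpotentGroup.basis X c) →◃ R :=
    { toFun := fun q => ρ (w q) • f (x q)
      map_act' := fun {p q} => by
        have h := hspec (p ◃ q) (w p * FreeGroup.of (x p) * (w p)⁻¹ * w q) (x q) (by
          change p.1 * q.1 * p.1⁻¹ = _
          rw [hwx p, hwx q, ← QuotientGroup.mk_inv, ← QuotientGroup.mk_mul, ← QuotientGroup.mk_mul]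
          congr 1
          group)
        rw [h, ← Inn.of_smul, Inn.of_smul_eq, ← hρ, ← map_mul, ← map_inv, ← map_mul, smul_smul,
          ← map_mul] }
  refine ⟨F, fun y => ?_, fun F' hF' => ?_⟩
  · have := hspec (ConjUnion.of (FreeNilpotentGroup.basis X c) y) 1 y (by simp; rfl)
    rwa [map_one, one_smul] at this
  · refine DFunLike.ext _ _ fun q => ?_
    -- Uniqueness: a morphism with the prescribed values on X is equivariant under F, and every
    -- element is an F-translate of a basis element.
    have h1 := ConjUnion.map_conjHom (b := FreeNilpotentGroup.basis X c)
      (QuotientGroup.mk' (Gam (FreeGroup X) (c + 1))) ρ F'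
      (fun y q => by
        rw [hρ, Inn.of_smul, ← hF' y, ← ShelfHom.map_act]
        rfl) (w q) (ConjUnion.of _ (x q))
    have h2 : ConjUnion.conjHom _ (QuotientGroup.mk' (Gam (FreeGroup X) (c + 1)) (w q))
        (ConjUnion.of (FreeNilpotentGroup.basis X c) (x q)) = q := Subtype.ext (hwx q).symm
    rw [h2, hF'] at h1
    exact h1

end UniversalProperty

/-! ### The quotient Q[X]/Γ_c and its enveloping group. -/

section EnvelopingGroup

variable (X : Type u) (c : ℕ)

theorem FreeQdl.conjHom_mem_Inn (w : FreeGroup X) :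
    ConjUnion.conjHom (FreeGroup.of : X → FreeGroup X) w ∈ Inn (FreeQdl X) := by
  have h : (⊤ : Subgroup (FreeGroup X)) ≤
      (Inn (FreeQdl X)).comap (ConjUnion.conjHom (FreeGroup.of : X → FreeGroup X)) := by
    rw [← FreeGroup.closure_range_of, Subgroup.closure_le]
    rintro _ ⟨x, rfl⟩
    exact (Inn.of (ConjUnion.of FreeGroup.of x)).2
  exact h (Subgroup.mem_top w)

variable {X c}

theorem FreeQdl.exists_eq_conjHom (q : FreeQdl X) : ∃ (w : FreeGroup X) (x : X),
    q = ConjUnion.conjHom FreeGroup.of w (ConjUnion.of FreeGroup.of x) := by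
  obtain ⟨g, x, hx⟩ := q
  obtain ⟨w, rfl⟩ := isConj_iff.1 hx
  exact ⟨w, x, rfl⟩

theorem FreeQdl.mk_conjHom {w : FreeGroup X} (hw : w ∈ Gam (FreeGroup X) c) (q : FreeQdl X) :
    QuandleModGam.mk c (ConjUnion.conjHom FreeGroup.of w q) = QuandleModGam.mk c q := by
  refine Quotient.sound ?_
  let κ := (ConjUnion.conjHom (FreeGroup.of : X → FreeGroup X)).codRestrict (Inn (FreeQdl X))
    (FreeQdl.conjHom_mem_Inn X)
  exact ⟨⟨κ w, Gam_map_mem κ hw⟩, rfl⟩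

theorem FreeQdl.mk_eq_of_mk_eq (hc : 1 ≤ c) {q q' : FreeQdl X}
    (h : (QuotientGroup.mk q.1 : FreeNilpotentGroup X c) = QuotientGroup.mk q'.1) :
    QuandleModGam.mk c q = QuandleModGam.mk c q' := by
  obtain ⟨w, x, rfl⟩ := q.exists_eq_conjHom
  obtain ⟨v, y, rfl⟩ := q'.exists_eq_conjHom
  obtain ⟨rfl, t, ht, k, rfl⟩ := eq_mul_zpow_of_mk_conj_eq hc h
  -- With w = v t xᵏ, the element w x w⁻¹ is the conjugate of v x v⁻¹ by v t v⁻¹, which lies in Γ_c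
  -- by normality.
  rw [← FreeQdl.mk_conjHom (Subgroup.Normal.conj_mem inferInstance t ht v)
    (ConjUnion.conjHom FreeGroup.of v (ConjUnion.of FreeGroup.of x))]
  congr 1
  refine Subtype.ext ?_
  change v * t * FreeGroup.of x ^ k * FreeGroup.of x * (v * t * FreeGroup.of x ^ k)⁻¹ =
    v * t * v⁻¹ * (v * FreeGroup.of x * v⁻¹) * (v * t * v⁻¹)⁻¹
  group

variable (X c)

/-- The morphism from `Q[X]/Γ_c` to `F[X]/Γ_{c+1}`. -/
def FreeQdl.toFreeNilpotentGroup (hc : 1 ≤ c) :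
    QuandleModGam (FreeQdl X) c →◃ Quandle.Conj (FreeNilpotentGroup X c) where
  toFun := Quotient.lift (fun q : FreeQdl X => (QuotientGroup.mk q.1 : FreeNilpotentGroup X c)) (by
    rintro _ q ⟨⟨g, hg⟩, rfl⟩
    obtain ⟨w, hw, hwg⟩ := ConjUnion.exists_conjHom_eq hg
    have h1 : (g • q).1 = w * q.1 * w⁻¹ := by
      rw [← ConjUnion.conjHom_coe, hwg]
      rfl
    change (QuotientGroup.mk (g • q).1 : FreeNilpotentGroup X c) = QuotientGroup.mk q.1
    rw [h1, eq_comm, QuotientGroup.eq]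
    -- For w in Γ_c, the elements w q w⁻¹ and q differ by a commutator [w, q], which lies in
    -- Γ_{c+1}.
    have h2 := Gam_commutator_mem hc le_rfl hw (Subgroup.mem_top q.1)
    convert Subgroup.Normal.conj_mem inferInstance _ h2 q.1⁻¹ using 1
    rw [commutatorElement_def]
    group)
  map_act' {p q} := by
    induction p using Quotient.inductionOn
    induction q using Quotient.inductionOn
    rfl

/-- The enveloping group of `Q[X]/Γ_c` is `F[X]/Γ_{c+1}`. -/
theorem FreeQdl.exists_envelGroup_equiv (hc : 1 ≤ c) :
    ∃ e : Rack.EnvelGroup (QuandleModGam (FreeQdl X) c) ≃* FreeNilpotentGroup X c,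
      ∀ q : FreeQdl X, e (Rack.toEnvelGroup _ (QuandleModGam.mk c q)) = QuotientGroup.mk q.1 := by
  let E := Rack.EnvelGroup (QuandleModGam (FreeQdl X) c)
  let η : FreeQdl X → E := fun q => Rack.toEnvelGroup _ (QuandleModGam.mk c q)
  let Φ : E →* FreeNilpotentGroup X c :=
    Rack.toEnvelGroup.map (FreeQdl.toFreeNilpotentGroup X c hc)
  have hΦ : ∀ q, Φ (η q) = QuotientGroup.mk q.1 := fun q => rfl
  let Ψ : FreeGroup X →* E := FreeGroup.lift fun x => η (ConjUnion.of _ x)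
  have hΨ_of : ∀ x, Ψ (FreeGroup.of x) = η (ConjUnion.of _ x) := fun x => by simp [Ψ]
  have hη : ∀ w q, η (ConjUnion.conjHom _ w q) = Ψ w * η q * (Ψ w)⁻¹ := fun w q => by
    refine ConjUnion.map_conjHom (MonoidHom.id _) (MulAut.conj.comp Ψ) η (fun x q => ?_) w q
    simp only [MonoidHom.comp_apply, MulAut.smul_def, MulAut.conj_apply, hΨ_of]
    exact (Rack.toEnvelGroup (QuandleModGam (FreeQdl X) c)).map_act
      (x := QuandleModGam.mk c (ConjUnion.of FreeGroup.of x)) (y := QuandleModGam.mk c q)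
  have hΨ : ∀ q : FreeQdl X, Ψ q.1 = η q := fun q => by
    obtain ⟨w, x, rfl⟩ := q.exists_eq_conjHom
    rw [hη, ConjUnion.conjHom_coe, map_mul, map_mul, map_inv, ← hΨ_of]
    rfl
  have hker : Gam (FreeGroup X) (c + 1) ≤ Ψ.ker := by
    have e : Gam (FreeGroup X) (c + 1) = ⁅Gam (FreeGroup X) c, (⊤ : Subgroup (FreeGroup X))⁆ := by
      obtain ⟨k, rfl⟩ := Nat.exists_eq_add_of_le' hc
      rfl
    rw [e, Subgroup.commutator_le]
    intro t ht v _
    rw [MonoidHom.mem_ker, map_commutatorElement, commutatorElement_eq_one_iff_mul_comm]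
    -- As t in Γ_c fixes the class of each x, its image commutes with the images of the basis
    -- elements, hence with the whole image of F.
    have h1 : (⊤ : Subgroup (FreeGroup X)) ≤ (Subgroup.centralizer {Ψ t}).comap Ψ := by
      rw [← FreeGroup.closure_range_of, Subgroup.closure_le]
      rintro _ ⟨x, rfl⟩
      refine Subgroup.mem_centralizer_singleton_iff.2 ?_
      have h2 := hη t (ConjUnion.of _ x)
      have h3 : η (ConjUnion.conjHom _ t (ConjUnion.of _ x)) = η (ConjUnion.of _ x) :=
        congrArg (Rack.toEnvelGroup _) (FreeQdl.mk_conjHom ht _)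
      rw [h3, ← hΨ_of, eq_mul_inv_iff_mul_eq] at h2
      exact h2
    exact (Subgroup.mem_centralizer_singleton_iff.1 (h1 (Subgroup.mem_top v))).symm
  let Ψ' : FreeNilpotentGroup X c →* E := QuotientGroup.lift _ Ψ hker
  refine ⟨MonoidHom.toMulEquiv Φ Ψ' ?_ ?_, hΦ⟩
  · apply Rack.toEnvelGroup.map.symm.injective
    refine DFunLike.ext _ _ fun q => ?_
    induction q using Quotient.inductionOn with
    | h q => exact hΨ q
  · refine QuotientGroup.monoidHom_ext _ (FreeGroup.ext_hom _ _ fun x => ?_)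
    change Φ (Ψ (FreeGroup.of x)) = _
    rw [hΨ_of, hΦ]
    rfl

end EnvelopingGroup

theorem proposition3 (X : Type u) (c : ℕ) (hc : 1 ≤ c) :
    -- the union of the conjugacy classes of the basis elements is disjoint
    (∀ x y : X, IsConj (FreeNilpotentGroup.basis X c x) (FreeNilpotentGroup.basis X c y) →
      x = y) ∧
    -- it is the free `c`-nilpotent quandle on `X`
    IsNilpotentQuandle c (ConjUnion (FreeNilpotentGroup.basis X c)) ∧
    (∀ (R : Type v) [Quandle R], IsNilpotentQuandle c R → ∀ f : X → R,
      ∃! F : ConjUnion (FreeNilpotentGroup.basis X c) →◃ R,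
        ∀ x, F (ConjUnion.of (FreeNilpotentGroup.basis X c) x) = f x) ∧
    -- the enveloping group of `Q[X]/Γ_c` is `F[X]/Γ_{c+1}`, and the canonical map from
    -- `Q[X]/Γ_c` to it is injective, with image the union of the conjugacy classes
    ∃ e : Rack.EnvelGroup (QuandleModGam (FreeQdl X) c) ≃* FreeNilpotentGroup X c,
      (∀ q : FreeQdl X,
        e (Rack.toEnvelGroup (QuandleModGam (FreeQdl X) c) (QuandleModGam.mk c q)) =
          QuotientGroup.mk (ConjUnion.incl FreeGroup.of q)) ∧
      Function.Injective (Rack.toEnvelGroup (QuandleModGam (FreeQdl X) c)) ∧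
      Set.range (fun q => e (Rack.toEnvelGroup (QuandleModGam (FreeQdl X) c) q)) =
        conjUnion (FreeNilpotentGroup.basis X c) := by
  obtain ⟨e, he⟩ := FreeQdl.exists_envelGroup_equiv X c hc
  refine ⟨fun x y => eq_of_isConj_basis hc,
    ConjUnion.isNilpotentQuandle hc (FreeNilpotentGroup.Gam_eq_bot X c),
    fun R _ hR f => existsUnique_extension hc hR f, e, he, ?_, ?_⟩
  · intro p q h
    induction p using Quotient.inductionOn with
    | h p =>
    induction q using Quotient.inductionOn with
    | h q =>
    exact FreeQdl.mk_eq_of_mk_eq hc ((he p).symm.trans ((congrArg e h).trans (he q)))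
  · ext g
    constructor
    · rintro ⟨q, rfl⟩
      induction q using Quotient.inductionOn with
      | h q =>
      obtain ⟨x, hx⟩ := q.2
      refine ⟨x, ?_⟩
      have h1 := (QuotientGroup.mk' (Gam (FreeGroup X) (c + 1))).map_isConj hx
      change IsConj _ (e (Rack.toEnvelGroup _ (QuandleModGam.mk c q)))
      rw [he]
      exact h1
    · intro hg
      obtain ⟨w, x, hw⟩ := exists_eq_mk_conj ⟨g, hg⟩
      refine ⟨QuandleModGam.mk c (ConjUnion.conjHom _ w (ConjUnion.of FreeGroup.of x)), ?_⟩
      exact (he _).trans hw.symm
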